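/- Let $(M,g)$ be a compact connected smooth Riemannian manifold without boundary, of dimension $n$. Let $X$ be a smooth vector field, $\lambda,\mu\in C^\infty(M)$ smooth functions and $\eta$ a smooth $1$-form on $M$ such that $(M,g)$ is an almost $\eta$-Ricci soliton with these data, that is, $$\mathrm{Ric}+\tfrac12\mathcal{L}_Xg=\lambda g+\mu\,\eta\otimes\eta .$$ Let $h\in C^\infty(M)$ be a Hodge–de Rham potential of $X$, that is, $X=\nabla h+Y$ for a smooth vector field $Y$ with $\operatorname{div}Y=0$. Suppose that, with the same $\lambda,\mu,\eta$, $(M,g)$ is also a gradient almost $\eta$-Ricci soliton with potential function $f\in C^\infty(M)$, that is, $$\mathrm{Ric}+\nabla^2f=\lambda g+\mu\,\eta\otimes\eta ,$$ where $\nabla^2 f$ is the Hessian of $f$. Then there is a constant $c\in\mathbb{R}$ with $f=h+c$ on $M$. -/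

import Mathlib

open Bundle Set
open scoped Manifold ContDiff Topology

noncomputable section

namespace Riem

/-- The model space `ℝⁿ`. -/
abbrev E (n : ℕ) : Type := EuclideanSpace ℝ (Fin n)

/-- A smooth Riemannian metric on the tangent bundle of an `n`-manifold without boundary. -/
abbrev Metric (n : ℕ) (M : Type*) [TopologicalSpace M] [ChartedSpace (E n) M]
    [IsManifold (𝓡 n) ∞ M] :=
  ContMDiffRiemannianMetric (𝓡 n) ∞ (E n) (fun p : M ↦ TangentSpace (𝓡 n) p)

/-- The partial derivative `∂ᵢ F` of a function on (an open subset of) `ℝⁿ`. -/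
def pd {n : ℕ} (i : Fin n) (F : E n → ℝ) (x : E n) : ℝ :=
  fderiv ℝ F x (EuclideanSpace.single i 1)

section Charts

variable {n : ℕ} {M : Type*} [TopologicalSpace M] [ChartedSpace (E n) M]

/-- The coordinate vector field `∂ᵢ` of the chart `e`, at the point with coordinates `x`. -/
def frame (e : OpenPartialHomeomorph M (E n)) (i : Fin n) (x : E n) :
    TangentSpace (𝓡 n) (e.symm x) :=
  mfderiv (𝓡 n) (𝓡 n) e.symm x (EuclideanSpace.single i 1 : E n)

/-- The component `Xⁱ` of a vector field in the chart `e`, so that `X = Xⁱ ∂ᵢ`. -/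
def vecComp (e : OpenPartialHomeomorph M (E n)) (X : ∀ p : M, TangentSpace (𝓡 n) p)
    (i : Fin n) (x : E n) : ℝ :=
  (EuclideanSpace.proj i : E n →L[ℝ] ℝ) (mfderiv (𝓡 n) (𝓡 n) e (e.symm x) (X (e.symm x)))

/-- The component `ηᵢ = η(∂ᵢ)` of a 1-form in the chart `e`. -/
def formComp (e : OpenPartialHomeomorph M (E n)) (η : ∀ p : M, TangentSpace (𝓡 n) p →L[ℝ] ℝ)
    (i : Fin n) (x : E n) : ℝ :=
  η (e.symm x) (frame e i x)

/-- The function `u` read in the chart `e`. -/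
def funComp (e : OpenPartialHomeomorph M (E n)) (u : M → ℝ) (x : E n) : ℝ := u (e.symm x)

/-- Smoothness of a vector field. -/
def SmoothVectorField [IsManifold (𝓡 n) ∞ M] (X : ∀ p : M, TangentSpace (𝓡 n) p) : Prop :=
  ContMDiff (𝓡 n) (𝓡 n).tangent ∞ (fun p ↦ (⟨p, X p⟩ : TangentBundle (𝓡 n) M))

/-- Smoothness of a 1-form. -/
def SmoothOneForm [IsManifold (𝓡 n) ∞ M] (η : ∀ p : M, TangentSpace (𝓡 n) p →L[ℝ] ℝ) : Prop :=
  ContMDiff (𝓡 n) ((𝓡 n).prod 𝓘(ℝ, E n →L[ℝ] ℝ)) ∞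
    (fun p ↦ TotalSpace.mk' (E n →L[ℝ] ℝ) (E := fun p : M ↦ TangentSpace (𝓡 n) p →L[ℝ] ℝ) p (η p))

variable [IsManifold (𝓡 n) ∞ M] (g : Metric n M)

/-- The matrix `(g_{ij})` of the metric in the chart `e`. -/
def gMat (e : OpenPartialHomeomorph M (E n)) (x : E n) : Matrix (Fin n) (Fin n) ℝ :=
  Matrix.of fun i j ↦ g.inner (e.symm x) (frame e i x) (frame e j x)

/-- The Christoffel symbol `Γᵏᵢⱼ = ½ gᵏˡ (∂ᵢ gⱼₗ + ∂ⱼ gᵢₗ - ∂ₗ gᵢⱼ)`. -/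
def christoffel (e : OpenPartialHomeomorph M (E n)) (k i j : Fin n) (x : E n) : ℝ :=
  (1 / 2) * ∑ l, (gMat g e x)⁻¹ k l *
    (pd i (fun y ↦ gMat g e y j l) x + pd j (fun y ↦ gMat g e y i l) x
      - pd l (fun y ↦ gMat g e y i j) x)

/-- The component `Ricᵢⱼ = ∂ₖ Γᵏᵢⱼ - ∂ⱼ Γᵏᵢₖ + Γᵏₖₗ Γˡᵢⱼ - Γᵏⱼₗ Γˡᵢₖ` of the Ricci tensor. -/
def ricci (e : OpenPartialHomeomorph M (E n)) (i j : Fin n) (x : E n) : ℝ :=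
  ∑ k, (pd k (christoffel g e k i j) x - pd j (christoffel g e k i k) x
    + ∑ l, (christoffel g e k k l x * christoffel g e l i j x
      - christoffel g e k j l x * christoffel g e l i k x))

/-- The component `(∇²u)ᵢⱼ = ∂ᵢ∂ⱼ u - Γᵏᵢⱼ ∂ₖ u` of the Hessian. -/
def hess (e : OpenPartialHomeomorph M (E n)) (u : M → ℝ) (i j : Fin n) (x : E n) : ℝ :=
  pd i (pd j (funComp e u)) x - ∑ k, christoffel g e k i j x * pd k (funComp e u) x

/-- The component `(𝓛_X g)ᵢⱼ = X(g(∂ᵢ, ∂ⱼ)) - g([X, ∂ᵢ], ∂ⱼ) - g(∂ᵢ, [X, ∂ⱼ])` of the Lie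
derivative of the metric, where `[X, ∂ᵢ] = -(∂ᵢ Xᵏ) ∂ₖ`. -/
def lieMetric (e : OpenPartialHomeomorph M (E n)) (X : ∀ p : M, TangentSpace (𝓡 n) p)
    (i j : Fin n) (x : E n) : ℝ :=
  ∑ k, (vecComp e X k x * pd k (fun y ↦ gMat g e y i j) x
    + pd i (vecComp e X k) x * gMat g e x k j + pd j (vecComp e X k) x * gMat g e x i k)

/-- The divergence `(1 / √det g) ∂ⱼ(√det g Xʲ)`. -/
def divergence (e : OpenPartialHomeomorph M (E n)) (X : ∀ p : M, TangentSpace (𝓡 n) p)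
    (x : E n) : ℝ :=
  (1 / √(gMat g e x).det) * ∑ j, pd j (fun y ↦ √(gMat g e y).det * vecComp e X j y) x

/-- The metric at a point as a bilinear form on the tangent space. -/
def bilin (p : M) : LinearMap.BilinForm ℝ (TangentSpace (𝓡 n) p) :=
  LinearMap.mk₂ ℝ (fun v w ↦ g.inner p v w) (by simp) (by simp) (by simp) (by simp)

theorem bilin_nondegenerate (p : M) : (bilin g p).Nondegenerate := by
  refine ⟨fun v hv ↦ ?_, fun v hv ↦ ?_⟩ <;>
  · by_contra h0
    exact (g.pos p v h0).ne' (hv v)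

instance tangentFiniteDimensional (p : M) : FiniteDimensional ℝ (TangentSpace (𝓡 n) p) :=
  inferInstanceAs (FiniteDimensional ℝ (E n))

/-- The gradient `∇u`: the vector field with `g(∇u, v) = du(v)` for every tangent vector `v`. -/
def grad (u : M → ℝ) (p : M) : TangentSpace (𝓡 n) p :=
  ((bilin g p).toDual (bilin_nondegenerate g p)).symm
    (mfderiv (𝓡 n) 𝓘(ℝ, ℝ) u p : TangentSpace (𝓡 n) p →L[ℝ] ℝ).toLinearMap

theorem inner_grad (u : M → ℝ) (p : M) (v : TangentSpace (𝓡 n) p) :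
    g.inner p (grad g u p) v = (mfderiv (𝓡 n) 𝓘(ℝ, ℝ) u p : TangentSpace (𝓡 n) p →L[ℝ] ℝ) v :=
  LinearMap.BilinForm.apply_toDual_symm_apply
    (hB := bilin_nondegenerate g p) _ v

/-- `(M, g)` with the smooth field `X`, smooth functions `lam`, `mu` and 1-form `η` is an almost
`η`-Ricci soliton: `Ric + ½ 𝓛_X g = lam g + mu η ⊗ η`. An equation of tensors is an equation of
components in every chart of the atlas. -/
structure IsAlmostEtaRicciSoliton (X : ∀ p : M, TangentSpace (𝓡 n) p) (lam mu : M → ℝ)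
    (η : ∀ p : M, TangentSpace (𝓡 n) p →L[ℝ] ℝ) : Prop where
  smooth_X : SmoothVectorField X
  smooth_lam : ContMDiff (𝓡 n) 𝓘(ℝ, ℝ) ∞ lam
  smooth_mu : ContMDiff (𝓡 n) 𝓘(ℝ, ℝ) ∞ mu
  smooth_η : SmoothOneForm η
  eqn : ∀ e ∈ atlas (E n) M, ∀ x ∈ e.target, ∀ i j : Fin n,
    ricci g e i j x + (1 / 2) * lieMetric g e X i j x
      = lam (e.symm x) * gMat g e x i j + mu (e.symm x) * (formComp e η i x * formComp e η j x)

/-- `(M, g)` is a gradient almost `η`-Ricci soliton with potential `f`: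
`Ric + ∇²f = lam g + mu η ⊗ η`. -/
structure IsGradientAlmostEtaRicciSoliton (f lam mu : M → ℝ)
    (η : ∀ p : M, TangentSpace (𝓡 n) p →L[ℝ] ℝ) : Prop where
  smooth_f : ContMDiff (𝓡 n) 𝓘(ℝ, ℝ) ∞ f
  smooth_lam : ContMDiff (𝓡 n) 𝓘(ℝ, ℝ) ∞ lam
  smooth_mu : ContMDiff (𝓡 n) 𝓘(ℝ, ℝ) ∞ mu
  smooth_η : SmoothOneForm η
  eqn : ∀ e ∈ atlas (E n) M, ∀ x ∈ e.target, ∀ i j : Fin n,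
    ricci g e i j x + hess g e f i j x
      = lam (e.symm x) * gMat g e x i j + mu (e.symm x) * (formComp e η i x * formComp e η j x)

/-- `h` is a Hodge–de Rham potential of the vector field `X`: `h` is smooth and `X = ∇h + Y` for a
smooth vector field `Y` with `div Y = 0`. -/
def IsHodgeDeRhamPotential (X : ∀ p : M, TangentSpace (𝓡 n) p) (h : M → ℝ) : Prop :=
  ContMDiff (𝓡 n) 𝓘(ℝ, ℝ) ∞ h ∧
  ∃ Y : ∀ p : M, TangentSpace (𝓡 n) p, SmoothVectorField Y ∧
    (∀ e ∈ atlas (E n) M, ∀ x ∈ e.target, divergence g e Y x = 0) ∧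
    ∀ p, X p = grad g h p + Y p

end Charts

end Riem

end

/-! Subtracting the two soliton equations cancels `Ric`, `lam`, `mu` and `η` and leaves `∇²f = ½ 𝓛_X
g`. Since `X = ∇h + Y` and `𝓛_{∇h} g = 2 ∇²h` (`lieMetric_grad`), this says `∇²(f - h) = ½ 𝓛_Y g`.
The trace of the right side is `div Y = 0` (`trace_lieMetric`), so `f - h` is harmonic, hence
constant on a compact connected manifold.

The last step uses no integration. In a chart the Laplacian is an elliptic operator `gⁱʲ ∂ᵢ∂ⱼ + bᵏ
∂ₖ` with continuous coefficients and no zeroth order term, so Hopf's strong maximum principle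
(`eventually_eq_of_isMaxOn`) makes the set where `f - h` is maximal open. It is also closed, and
nonempty by compactness. -/

namespace Riem

/-! ### Elliptic operators on `ℝⁿ` and Hopf's strong maximum principle -/

section SecondOrder

variable {n : ℕ}

theorem pd_pd_eq_fderiv_fderiv {w : E n → ℝ} {x : E n} (hw : ContDiffAt ℝ 2 w x) (i j : Fin n) :
    pd i (pd j w) x =
      fderiv ℝ (fderiv ℝ w) x (EuclideanSpace.single i 1) (EuclideanSpace.single j 1) := by
  have h : DifferentiableAt ℝ (fderiv ℝ w) x :=
    (hw.fderiv_right (m := 1) (by norm_num)).differentiableAt (by norm_num)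
  unfold pd
  rw [fderiv_clm_apply h (by fun_prop)]
  simp

/-- The second derivative of a function of one variable is nonpositive at a local maximum. -/
theorem deriv_deriv_nonpos_of_isLocalMax {φ : ℝ → ℝ} {t : ℝ} (hφ : ContDiffAt ℝ 2 φ t)
    (hmax : IsLocalMax φ t) : deriv (deriv φ) t ≤ 0 := by
  by_contra! hpos
  -- A positive second derivative would make `t` a local minimum as well, so `φ` would be locally
  -- constant and its second derivative zero.
  have hmin := isLocalMin_of_deriv_deriv_pos hpos hmax.deriv_eq_zero hφ.continuousAt
  have hc : φ =ᶠ[𝓝 t] fun _ ↦ φ t := by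
    filter_upwards [hmax, hmin] with s h₁ h₂ using le_antisymm h₁ h₂
  have h := hc.deriv.deriv_eq
  simp at h
  exact hpos.ne' h

/-- Restriction to the line `x + t • v` reduces this to one variable. -/
theorem fderiv_fderiv_apply_self_nonpos_of_isLocalMax {w : E n → ℝ} {x : E n}
    (hw : ContDiffAt ℝ 2 w x) (hmax : IsLocalMax w x) (v : E n) :
    fderiv ℝ (fderiv ℝ w) x v v ≤ 0 := by
  set l : ℝ → E n := fun t ↦ x + t • v with hl
  have hl0 : l 0 = x := by simp [hl]
  have hlc : ContDiff ℝ 2 l := by fun_prop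
  have hd : ∀ t, HasDerivAt l v t := fun t ↦ by
    have h := ((hasDerivAt_id t).smul_const v).const_add x
    rwa [one_smul] at h
  have hw' : ContDiffAt ℝ 2 w (l 0) := by rwa [hl0]
  have hmax' : IsLocalMax (w ∘ l) 0 := by
    have : Filter.Tendsto l (𝓝 0) (𝓝 x) := by
      simpa [hl0] using hlc.continuous.tendsto 0
    simpa [IsLocalMax, IsMaxFilter, hl0] using this.eventually hmax
  have h₁ : deriv (w ∘ l) =ᶠ[𝓝 0] fun t ↦ fderiv ℝ w (l t) v := by
    have h2 : ∀ᶠ y in 𝓝 (l 0), ContDiffAt ℝ 2 w y := hw'.eventually (by simp)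
    filter_upwards [hlc.continuous.continuousAt.eventually h2] with t ht
    exact ((ht.differentiableAt (by norm_num)).hasFDerivAt.comp_hasDerivAt t (hd t)).deriv
  have h₂ : deriv (deriv (w ∘ l)) 0 = fderiv ℝ (fderiv ℝ w) x v v := by
    rw [h₁.deriv_eq]
    have h : DifferentiableAt ℝ (fderiv ℝ w) (l 0) :=
      (hw'.fderiv_right (m := 1) (by norm_num)).differentiableAt (by norm_num)
    have h3 := (h.hasFDerivAt.comp_hasDerivAt (0 : ℝ) (hd 0)).clm_apply (hasDerivAt_const (0 : ℝ) v)
    simpa [hl0] using h3.deriv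
  rw [← h₂]
  exact deriv_deriv_nonpos_of_isLocalMax (hw'.comp 0 hlc.contDiffAt) hmax'

theorem exists_conjTranspose_mul_self {A : Matrix (Fin n) (Fin n) ℝ} (hA : A.PosSemidef) :
    ∃ B : Matrix (Fin n) (Fin n) ℝ, A = B.conjTranspose * B := by
  open scoped MatrixOrder Matrix.Norms.L2Operator in
  exact CStarAlgebra.nonneg_iff_eq_star_mul_self.mp hA.nonneg

/-- With `A = Bᵀ B`, the contraction of `A` with `H` is the sum of `H v v` over the rows `v` of `B`.
-/
theorem sum_mul_nonpos_of_posSemidef {A : Matrix (Fin n) (Fin n) ℝ} (hA : A.PosSemidef)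
    (H : E n →L[ℝ] E n →L[ℝ] ℝ) (hH : ∀ v, H v v ≤ 0) :
    ∑ i, ∑ j, A i j * H (EuclideanSpace.single i 1) (EuclideanSpace.single j 1) ≤ 0 := by
  obtain ⟨B, rfl⟩ := exists_conjTranspose_mul_self hA
  have : ∑ i, ∑ j, (B.conjTranspose * B) i j *
      H (EuclideanSpace.single i 1) (EuclideanSpace.single j 1) =
      ∑ k, H (∑ i, B k i • EuclideanSpace.single i 1) (∑ i, B k i • EuclideanSpace.single i 1) := by
    simp only [Matrix.mul_apply, Matrix.conjTranspose_apply, star_trivial, map_sum, map_smul,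
      sum_apply, smul_apply, smul_eq_mul, Finset.sum_mul,
      Finset.mul_sum]
    conv_rhs => rw [Finset.sum_comm]; enter [2, i]; rw [Finset.sum_comm]
    rw [Finset.sum_comm]
    simp only [mul_left_comm, mul_assoc]
  rw [this]
  exact Finset.sum_nonpos fun k _ ↦ hH _

/-- The operator `aⁱʲ ∂ᵢ∂ⱼ + bᵏ ∂ₖ`. -/
noncomputable def secondOrderOp (a : E n → Matrix (Fin n) (Fin n) ℝ) (b : E n → Fin n → ℝ)
    (w : E n → ℝ) (x : E n) : ℝ :=
  ∑ i, ∑ j, a x i j * pd i (pd j w) x + ∑ k, b x k * pd k w x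

variable {a : E n → Matrix (Fin n) (Fin n) ℝ} {b : E n → Fin n → ℝ}

theorem secondOrderOp_nonpos_of_isLocalMax {w : E n → ℝ} {x : E n} (ha : (a x).PosSemidef)
    (hw : ContDiffAt ℝ 2 w x) (hmax : IsLocalMax w x) : secondOrderOp a b w x ≤ 0 := by
  have h₁ : ∀ k, pd k w x = 0 := fun k ↦ by simp [pd, hmax.fderiv_eq_zero]
  simp only [secondOrderOp, h₁, mul_zero, Finset.sum_const_zero, add_zero,
    pd_pd_eq_fderiv_fderiv hw]
  exact sum_mul_nonpos_of_posSemidef ha _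
    (fderiv_fderiv_apply_self_nonpos_of_isLocalMax hw hmax)

theorem secondOrderOp_add_smul {u v : E n → ℝ} {x : E n} (hu : ContDiffAt ℝ 2 u x)
    (hv : ContDiffAt ℝ 2 v x) (c : ℝ) :
    secondOrderOp a b (fun y ↦ u y + c * v y) x =
      secondOrderOp a b u x + c * secondOrderOp a b v x := by
  have hpd : ∀ (j : Fin n) (y : E n), ContDiffAt ℝ 2 u y → ContDiffAt ℝ 2 v y →
      pd j (fun y ↦ u y + c * v y) y = pd j u y + c * pd j v y := fun j y h₁ h₂ ↦ by
    have h₁' := h₁.differentiableAt (by norm_num)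
    have h₂' := h₂.differentiableAt (by norm_num)
    simp only [pd]
    rw [fderiv_fun_add h₁' (h₂'.const_mul c), fderiv_const_mul h₂']
    simp
  have hpd2 : ∀ i j : Fin n, pd i (pd j fun y ↦ u y + c * v y) x =
      pd i (pd j u) x + c * pd i (pd j v) x := fun i j ↦ by
    have he : pd j (fun y ↦ u y + c * v y) =ᶠ[𝓝 x] fun y ↦ pd j u y + c * pd j v y := by
      filter_upwards [hu.eventually (by simp), hv.eventually (by simp)] with y h₁ h₂
      exact hpd j y h₁ h₂
    have hd : ∀ w : E n → ℝ, ContDiffAt ℝ 2 w x → DifferentiableAt ℝ (pd j w) x := fun w hw ↦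
      ((hw.fderiv_right (m := 1) (by norm_num)).differentiableAt (by norm_num)).clm_apply
        (differentiableAt_const _)
    rw [pd, he.fderiv_eq, fderiv_fun_add (hd u hu) ((hd v hv).const_mul c),
      fderiv_const_mul (hd v hv)]
    simp [pd]
  simp only [secondOrderOp, hpd _ _ hu hv, hpd2, mul_add, Finset.sum_add_distrib, Finset.mul_sum]
  have e : ∀ p q : ℝ, p * (c * q) = c * (p * q) := fun p q ↦ by ring
  simp only [e]
  ring

theorem continuousAt_secondOrderOp {w : E n → ℝ} {x : E n}
    (ha : ∀ i j, ContinuousAt (fun y ↦ a y i j) x)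
    (hb : ∀ k, ContinuousAt (fun y ↦ b y k) x) (hw : ContDiff ℝ 2 w) :
    ContinuousAt (secondOrderOp a b w) x := by
  have h₁ : ∀ k, ContDiff ℝ 1 (pd k w) := fun k ↦
    (hw.fderiv_right (m := 1) (by norm_num)).clm_apply contDiff_const
  have h₂ : ∀ i j, Continuous (pd i (pd j w)) := fun i j ↦
    ((h₁ j).continuous_fderiv (by norm_num)).clm_apply continuous_const
  unfold secondOrderOp
  refine ContinuousAt.add ?_ ?_
  · exact tendsto_finsetSum _ fun i _ ↦ tendsto_finsetSum _ fun j _ ↦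
      (ha i j).mul (h₂ i j).continuousAt
  · exact tendsto_finsetSum _ fun k _ ↦ (hb k).mul (h₁ k).continuous.continuousAt

/-- The function `s + β s²` with `s = ρ² - ‖x - y‖²`: it vanishes on the sphere of radius `ρ`
around `y` and, near that sphere, is negative outside. -/
def barrier (y : E n) (ρ β : ℝ) (x : E n) : ℝ :=
  (ρ ^ 2 - ∑ i, (x i - y i) ^ 2) + β * (ρ ^ 2 - ∑ i, (x i - y i) ^ 2) ^ 2

theorem contDiff_barrier (y : E n) (ρ β : ℝ) : ContDiff ℝ 2 (barrier y ρ β) := by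
  unfold barrier
  fun_prop

theorem hasFDerivAt_coord_sub (y : E n) (i : Fin n) (x : E n) :
    HasFDerivAt (fun z : E n ↦ z i - y i) (EuclideanSpace.proj i : E n →L[ℝ] ℝ) x :=
  (EuclideanSpace.proj i : E n →L[ℝ] ℝ).hasFDerivAt.sub_const _

theorem hasFDerivAt_sq_radius_sub (y : E n) (ρ : ℝ) (x : E n) :
    HasFDerivAt (fun z : E n ↦ ρ ^ 2 - ∑ i, (z i - y i) ^ 2)
      (-∑ i, (2 * (x i - y i)) • (EuclideanSpace.proj i : E n →L[ℝ] ℝ)) x := by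
  refine (HasFDerivAt.fun_sum fun i _ ↦ ?_).const_sub _
  simpa using (hasFDerivAt_coord_sub y i x).pow 2

theorem pd_barrier (y : E n) (ρ β : ℝ) (j : Fin n) (x : E n) :
    pd j (barrier y ρ β) x =
      (1 + 2 * β * (ρ ^ 2 - ∑ i, (x i - y i) ^ 2)) * (-2 * (x j - y j)) := by
  have h := hasFDerivAt_sq_radius_sub y ρ x
  have h' := (h.add ((h.pow 2).const_mul β)).fderiv
  unfold pd barrier
  erw [h']
  simp
  ring

theorem pd_pd_barrier (y : E n) (ρ β : ℝ) (i j : Fin n) (x : E n) :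
    pd i (pd j (barrier y ρ β)) x =
      (1 + 2 * β * (ρ ^ 2 - ∑ i, (x i - y i) ^ 2)) * (-2 * if i = j then 1 else 0) +
        8 * β * ((x i - y i) * (x j - y j)) := by
  have h := hasFDerivAt_sq_radius_sub y ρ x
  have h' := (((h.const_mul (2 * β)).const_add 1).mul
    ((hasFDerivAt_coord_sub y j x).const_mul (-2))).fderiv
  rw [funext (pd_barrier y ρ β j)]
  unfold pd
  erw [h']
  simp [eq_comm]
  split_ifs <;> ring

/-- At a point of the sphere `s = 0`, so `β` enters the operator only through `8 β Q`, where `Q` is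
the quadratic form of `a z` at `z - y ≠ 0`. Ellipticity gives `Q > 0`, and a large `β` wins. -/
theorem exists_barrier_pos {y z : E n} {ρ : ℝ} (hz : ρ ^ 2 = ∑ i, (z i - y i) ^ 2) (hne : z ≠ y)
    (ha : (a z).PosDef) : ∃ β : ℝ, 0 < secondOrderOp a b (barrier y ρ β) z := by
  set Q : ℝ := ∑ i, ∑ j, a z i j * ((z i - y i) * (z j - y j)) with hQ
  set C : ℝ := ∑ i, ∑ j, a z i j * (-2 * if i = j then 1 else 0) +
    ∑ k, b z k * (-2 * (z k - y k)) with hC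
  have hop : ∀ β, secondOrderOp a b (barrier y ρ β) z = C + 8 * β * Q := fun β ↦ by
    simp only [secondOrderOp, pd_barrier, pd_pd_barrier, hz, sub_self, mul_zero, add_zero, one_mul,
      mul_add, Finset.sum_add_distrib, hQ, hC, Finset.mul_sum]
    have e : ∀ p q : ℝ, p * (8 * β * q) = 8 * β * (p * q) := fun p q ↦ by ring
    simp only [e]
    ring
  have hQpos : 0 < Q := by
    have hd : (fun i ↦ z i - y i) ≠ 0 := fun h ↦ hne (by
      ext i
      exact sub_eq_zero.mp (congrFun h i))
    have h := ha.dotProduct_mulVec_pos hd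
    simp only [dotProduct, Matrix.mulVec, star_trivial, Finset.mul_sum] at h
    refine h.trans_eq (Finset.sum_congr rfl fun i _ ↦ Finset.sum_congr rfl fun j _ ↦ ?_)
    ring
  -- This choice makes `8 β Q = |C| + 1`, which exceeds `-C`.
  refine ⟨(|C| + 1) / (8 * Q), ?_⟩
  rw [hop]
  have : 8 * ((|C| + 1) / (8 * Q)) * Q = |C| + 1 := by field_simp
  rw [this]
  linarith [neg_abs_le C]

theorem sum_sq_sub_eq_dist_sq (x y : E n) : ∑ i, (x i - y i) ^ 2 = dist x y ^ 2 := by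
  rw [dist_eq_norm, EuclideanSpace.real_norm_sq_eq]
  rfl

/-- If `L u = 0` for an elliptic operator `L`, the set where `u` is maximal cannot touch a ball on
which `u` is not maximal from outside in exactly one point. -/
theorem false_of_touching {U : Set (E n)} (hU : IsOpen U) {u : E n → ℝ} (hu : ContDiffOn ℝ 2 u U)
    (ha : ∀ i j, ContinuousOn (fun x ↦ a x i j) U) (hpos : ∀ x ∈ U, (a x).PosDef)
    (hb : ∀ k, ContinuousOn (fun x ↦ b x k) U) (hL : ∀ x ∈ U, secondOrderOp a b u x = 0)
    {y z : E n} (hzU : z ∈ U) (hne : z ≠ y) (hmax : ∀ x ∈ U, u x ≤ u z)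
    (hlt : ∀ x ∈ U, dist x y ≤ dist z y → x ≠ z → u x < u z) : False := by
  obtain ⟨β, hLz⟩ := exists_barrier_pos (b := b) (sum_sq_sub_eq_dist_sq z y).symm hne
    (hpos z hzU)
  set v := barrier y (dist z y) β with hv
  have hvd : ContDiff ℝ 2 v := contDiff_barrier _ _ _
  have hvx : ∀ x, v x = (dist z y ^ 2 - dist x y ^ 2) * (1 + β * (dist z y ^ 2 - dist x y ^ 2)) :=
    fun x ↦ by
      rw [hv, barrier, sum_sq_sub_eq_dist_sq]
      ring
  have hUz : U ∈ 𝓝 z := hU.mem_nhds hzU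
  have hcont : ContinuousAt (secondOrderOp a b v) z :=
    continuousAt_secondOrderOp (fun i j ↦ (ha i j).continuousAt hUz)
      (fun k ↦ (hb k).continuousAt hUz) hvd
  have hs : ∀ᶠ x in 𝓝 z, 0 < 1 + β * (dist z y ^ 2 - dist x y ^ 2) := by
    have hc : ContinuousAt (fun x ↦ 1 + β * (dist z y ^ 2 - dist x y ^ 2)) z := by fun_prop
    exact hc.eventually_const_lt (by simp)
  -- On this small ball `L v > 0`, and the second factor of `v` is positive, so that `v` has the
  -- sign of `dist z y ^ 2 - dist x y ^ 2`.
  obtain ⟨δ, hδ, hball⟩ := Metric.nhds_basis_closedBall.mem_iff.mp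
    (Filter.inter_mem hUz (Filter.inter_mem (hcont.eventually_const_lt hLz) hs))
  have hballU : Metric.closedBall z δ ⊆ U := fun x hx ↦ (hball hx).1
  have huc : ContinuousOn u (Metric.closedBall z δ) := hu.continuousOn.mono hballU
  set K := Metric.sphere z δ ∩ Metric.closedBall y (dist z y) with hK
  have hKc : IsCompact K := (isCompact_sphere z δ).inter_right Metric.isClosed_closedBall
  -- The part `K` of the small sphere inside the touching ball is compact and misses `z`, so `u`
  -- stays below `u z` there by a definite gap. `K` may be empty.
  obtain ⟨m, hm, hKm⟩ : ∃ m < u z, ∀ x ∈ K, u x ≤ m := by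
    rcases K.eq_empty_or_nonempty with h | h
    · exact ⟨u z - 1, by linarith, by simp [h]⟩
    · obtain ⟨q, hq, hqm⟩ := hKc.exists_isMaxOn h
        (huc.mono fun x hx ↦ Metric.sphere_subset_closedBall hx.1)
      refine ⟨u q, hlt q (hballU (Metric.sphere_subset_closedBall hq.1)) hq.2 ?_, fun x hx ↦ hqm hx⟩
      rintro rfl
      simpa [hδ.ne] using hq.1
  obtain ⟨C, hC, hKC⟩ : ∃ C > 0, ∀ x ∈ K, v x ≤ C := by
    obtain ⟨C, hC⟩ := (hKc.image hvd.continuous).bddAbove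
    exact ⟨max C 1, by positivity, fun x hx ↦ (hC (mem_image_of_mem v hx)).trans (le_max_left _ _)⟩
  -- With this `ε` the perturbation `ε v` cannot exceed the gap `u z - m` on `K`; on the rest of the
  -- sphere `v ≤ 0`.
  set ε := (u z - m) / C with hε
  have hεpos : 0 < ε := div_pos (by linarith) hC
  have hwz : u z + ε * v z = u z := by simp [hvx]
  have hsphere : ∀ x ∈ Metric.sphere z δ, u x + ε * v x ≤ u z + ε * v z := fun x hx ↦ by
    have hxb := Metric.sphere_subset_closedBall hx
    rw [hwz]
    by_cases hxy : dist x y ≤ dist z y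
    · have h₁ := hKm x ⟨hx, hxy⟩
      have h₂ := mul_le_mul_of_nonneg_left (hKC x ⟨hx, hxy⟩) hεpos.le
      have h₃ : ε * C = u z - m := div_mul_cancel₀ _ hC.ne'
      linarith
    · have h₁ : v x ≤ 0 := by
        rw [hvx]
        refine mul_nonpos_of_nonpos_of_nonneg ?_ (hball hxb).2.2.le
        have := pow_le_pow_left₀ dist_nonneg (not_le.mp hxy).le 2
        linarith
      have h₂ := mul_nonpos_of_nonneg_of_nonpos hεpos.le h₁
      linarith [hmax x (hballU hxb)]
  -- If the maximum over the closed ball is attained on its boundary, then the centre `z` attains it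
  -- too, so an interior maximum always exists.
  obtain ⟨q, hq, hqm⟩ : ∃ q ∈ Metric.ball z δ,
      IsMaxOn (fun x ↦ u x + ε * v x) (Metric.closedBall z δ) q := by
    obtain ⟨q, hq, hqm⟩ := (isCompact_closedBall z δ).exists_isMaxOn
      (f := fun x ↦ u x + ε * v x) ⟨z, Metric.mem_closedBall_self hδ.le⟩
      (huc.add (continuousOn_const.mul hvd.continuous.continuousOn))
    rcases (Metric.mem_closedBall.mp hq).lt_or_eq with h | h
    · exact ⟨q, h, hqm⟩
    · exact ⟨z, Metric.mem_ball_self hδ, fun x hx ↦ (hqm hx).trans (hsphere q h)⟩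
  have hqc := Metric.ball_subset_closedBall hq
  have hqd : ContDiffAt ℝ 2 u q := hu.contDiffAt (hU.mem_nhds (hballU hqc))
  have hloc : IsLocalMax (fun x ↦ u x + ε * v x) q :=
    hqm.isLocalMax (Filter.mem_of_superset (Metric.isOpen_ball.mem_nhds hq)
      Metric.ball_subset_closedBall)
  -- At the interior maximum `L (u + ε v) ≤ 0`, whereas `L u = 0` and `ε L v > 0`.
  have h₁ := secondOrderOp_nonpos_of_isLocalMax (b := b) (hpos q (hballU hqc)).posSemidef
    (hqd.add (contDiffAt_const.mul hvd.contDiffAt)) hloc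
  rw [secondOrderOp_add_smul hqd hvd.contDiffAt, hL q (hballU hqc), zero_add] at h₁
  exact absurd h₁ (not_le.mpr (mul_pos hεpos (hball hqc).2.1))

/-- The strong maximum principle: a solution of `L u = 0` which attains its maximum at an interior
point is constant near that point. -/
theorem eventually_eq_of_isMaxOn {U : Set (E n)} (hU : IsOpen U) {u : E n → ℝ}
    (hu : ContDiffOn ℝ 2 u U) (ha : ∀ i j, ContinuousOn (fun x ↦ a x i j) U)
    (hpos : ∀ x ∈ U, (a x).PosDef) (hb : ∀ k, ContinuousOn (fun x ↦ b x k) U)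
    (hL : ∀ x ∈ U, secondOrderOp a b u x = 0) {x₀ : E n} (hx₀ : x₀ ∈ U)
    (hmax : ∀ x ∈ U, u x ≤ u x₀) : ∀ᶠ x in 𝓝 x₀, u x = u x₀ := by
  obtain ⟨r, hr, hball⟩ := Metric.nhds_basis_closedBall.mem_iff.mp (hU.mem_nhds hx₀)
  set A := Metric.closedBall x₀ r ∩ u ⁻¹' {u x₀} with hA
  have hAc : IsCompact A := (isCompact_closedBall x₀ r).of_isClosed_subset
    ((hu.continuousOn.mono hball).preimage_isClosed_of_isClosed Metric.isClosed_closedBall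
      isClosed_singleton) inter_subset_left
  have hxA : x₀ ∈ A := ⟨Metric.mem_closedBall_self hr.le, rfl⟩
  -- Half the radius suffices: points no farther from `y` than `x₀` is then remain in `closedBall x₀
  -- r`.
  filter_upwards [Metric.ball_mem_nhds x₀ (half_pos hr)] with y hy
  by_contra hne
  obtain ⟨z, hz, hzmin⟩ := hAc.exists_isMinOn ⟨x₀, hxA⟩
    (f := fun x ↦ dist x y) (by fun_prop)
  have hzx : dist z y ≤ dist x₀ y := hzmin hxA
  have hzu : u z = u x₀ := hz.2
  have hzy : z ≠ y := by
    rintro rfl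
    exact hne hzu
  rw [Metric.mem_ball, dist_comm] at hy
  -- The ball with diameter `[y, z]` touches `A` only in `z`.
  have hdist : dist (midpoint ℝ y z) y = dist z y / 2 := by
    rw [dist_midpoint_left]; simp [dist_comm]; ring
  have hdist' : dist z (midpoint ℝ y z) = dist z y / 2 := by
    rw [dist_right_midpoint]; simp [dist_comm]; ring
  refine false_of_touching hU hu ha hpos hb hL (y := midpoint ℝ y z) (hball hz.1) (fun h ↦ ?_)
    (fun x hx ↦ hzu ▸ hmax x hx) fun x hx hxd hxz ↦ ?_
  · rw [← h] at hdist
    have := dist_pos.mpr hzy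
    linarith
  · refine lt_of_le_of_ne (hzu ▸ hmax x hx) fun hxu ↦ hxz ?_
    rw [hdist'] at hxd
    have hxy : dist x y ≤ dist z y := by
      linarith [dist_triangle x (midpoint ℝ y z) y]
    have hxA : x ∈ A := ⟨by
      rw [Metric.mem_closedBall]
      linarith [dist_triangle x y x₀, dist_comm y x₀], hxu.trans hzu⟩
    have hzx' : dist z y ≤ dist x y := hzmin hxA
    -- A second contact point `x` forces equality in the triangle inequality through the midpoint.
    -- By strict convexity of the Euclidean norm that point is also the midpoint of `y` and `x`,
    -- whence `x = z`.
    have htri := dist_triangle x (midpoint ℝ y z) y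
    have hmid : midpoint ℝ y z = midpoint ℝ y x := by
      apply eq_midpoint_of_dist_eq_half <;> simp only [dist_comm y, dist_comm _ x] <;> linarith
    rw [midpoint_eq_smul_add, midpoint_eq_smul_add] at hmid
    exact (add_left_cancel (smul_right_injective _ (by norm_num : (⅟2 : ℝ) ≠ 0) hmid)).symm

end SecondOrder

/-! ### The derivative of a determinant -/

section Coordinates

variable {n : ℕ}

/-- Jacobi's formula for the partial derivatives of a determinant. -/
theorem differentiableAt_det_and_pd_det {G : E n → Matrix (Fin n) (Fin n) ℝ} {x : E n}
    (hG : ∀ i j, DifferentiableAt ℝ (fun y ↦ G y i j) x) :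
    DifferentiableAt ℝ (fun y ↦ (G y).det) x ∧ ∀ k, pd k (fun y ↦ (G y).det) x =
      ∑ i, ∑ j, (G x).adjugate j i * pd k (fun y ↦ G y i j) x := by
  -- The determinant is multilinear in the rows, so its derivative is the sum of the determinants
  -- with one row differentiated; Cramer's rule turns each into a row of adjugate entries.
  let D : ContinuousMultilinearMap ℝ (fun _ : Fin n ↦ (Fin n → ℝ)) ℝ :=
    ⟨(Matrix.detRowAlternating (n := Fin n) (R := ℝ)).toMultilinearMap, by
      exact Continuous.matrix_det continuous_id⟩
  have hrow : ∀ i, HasFDerivAt (fun y ↦ G y i)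
      (ContinuousLinearMap.pi fun j ↦ fderiv ℝ (fun y ↦ G y i j) x) x := fun i ↦
    hasFDerivAt_pi.mpr fun j ↦ (hG i j).hasFDerivAt
  have h := HasFDerivAt.multilinear_comp D hrow
  have hD : ∀ y, (D fun i ↦ G y i) = (G y).det := fun y ↦ rfl
  simp only [hD] at h
  refine ⟨h.differentiableAt, fun k ↦ ?_⟩
  rw [pd, h.fderiv]
  simp only [sum_apply, ContinuousLinearMap.comp_apply]
  refine Finset.sum_congr rfl fun i _ ↦ ?_
  trans ((G x).updateRow i fun j ↦ pd k (fun y ↦ G y i j) x).det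
  · rfl
  · rw [← Matrix.cramer_transpose_apply, Matrix.cramer_eq_adjugate_mulVec,
      ← Matrix.adjugate_transpose]
    rfl

end Coordinates

/-! ### Coordinate frames and smoothness of components -/

section ChartSmoothness

variable {n : ℕ} {M : Type*} [TopologicalSpace M] [ChartedSpace (E n) M]
  {e : OpenPartialHomeomorph M (E n)}

theorem mfderiv_chart_symm_apply (x w : E n) :
    mfderiv (𝓡 n) (𝓡 n) e.symm x w = ∑ k, w k • frame e k x := by
  have hsum : w = ∑ k, w k • (EuclideanSpace.single k 1 : E n) := by
    ext i
    simp [Finset.sum_apply, Pi.single_apply]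
  let A : E n →L[ℝ] E n := mfderiv (𝓡 n) (𝓡 n) e.symm x
  have h : A w = ∑ k, w k • A (EuclideanSpace.single k 1) := by
    conv_lhs => rw [hsum]
    simp only [map_sum, map_smul]
  exact h

variable [IsManifold (𝓡 n) ∞ M]

theorem contMDiffOn_chart_symm (he : e ∈ atlas (E n) M) :
    ContMDiffOn (𝓡 n) (𝓡 n) ∞ e.symm e.target :=
  contMDiffOn_symm_of_mem_maximalAtlas (IsManifold.subset_maximalAtlas he)

theorem contMDiffOn_chart (he : e ∈ atlas (E n) M) : ContMDiffOn (𝓡 n) (𝓡 n) ∞ e e.source :=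
  contMDiffOn_of_mem_maximalAtlas (IsManifold.subset_maximalAtlas he)

theorem mdifferentiable_chart (he : e ∈ atlas (E n) M) : e.MDifferentiable (𝓡 n) (𝓡 n) :=
  have : IsManifold (𝓡 n) 1 M := IsManifold.of_le (n := ∞) (by simp)
  mdifferentiable_of_mem_atlas he

/-- The frame field is the image of a constant vector field under the tangent map of `e.symm`. -/
theorem contMDiffOn_frame (he : e ∈ atlas (E n) M) (i : Fin n) :
    ContMDiffOn (𝓡 n) (𝓡 n).tangent ∞
      (fun x ↦ (⟨e.symm x, frame e i x⟩ : TangentBundle (𝓡 n) M)) e.target := by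
  have : IsManifold (𝓡 n) 1 M := IsManifold.of_le (n := ∞) (by simp)
  have h := (contMDiffOn_chart_symm he).contMDiffOn_tangentMapWithin (m := ∞) (by simp)
    e.open_target.uniqueMDiffOn
  have hs : ContMDiff (𝓡 n) (𝓡 n).tangent ∞
      (fun x : E n ↦ (⟨x, (EuclideanSpace.single i 1 : E n)⟩ : TangentBundle (𝓡 n) (E n))) :=
    contMDiff_vectorSpace_iff_contDiff.mpr contDiff_const
  refine (h.comp hs.contMDiffOn fun x hx ↦ hx).congr fun x hx ↦ ?_
  simp only [Function.comp, tangentMapWithin, mfderivWithin_of_isOpen e.open_target hx]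
  rfl

theorem contDiffOn_gMat (g : Metric n M) (he : e ∈ atlas (E n) M) (i j : Fin n) :
    ContDiffOn ℝ ∞ (fun x ↦ gMat g e x i j) e.target := by
  rw [← contMDiffOn_iff_contDiffOn]
  have hg := g.contMDiff.contMDiffOn.comp (t := univ) (contMDiffOn_chart_symm he) (by simp)
  have h := ContMDiffOn.clm_bundle_apply₂ (F₁ := E n) (F₂ := E n) (F₃ := ℝ)
    (E₁ := fun p : M ↦ TangentSpace (𝓡 n) p) (E₂ := fun p : M ↦ TangentSpace (𝓡 n) p)
    (E₃ := Bundle.Trivial M ℝ) hg (contMDiffOn_frame he i) (contMDiffOn_frame he j)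
  intro x hx
  exact ((contMDiffWithinAt_totalSpace.mp (h x hx)).2)

theorem contDiffOn_vecComp (he : e ∈ atlas (E n) M) {X : ∀ p : M, TangentSpace (𝓡 n) p}
    (hX : SmoothVectorField X) (i : Fin n) : ContDiffOn ℝ ∞ (vecComp e X i) e.target := by
  have : IsManifold (𝓡 n) 1 M := IsManifold.of_le (n := ∞) (by simp)
  have h := (contMDiffOn_chart he).contMDiffOn_tangentMapWithin (m := ∞) (by simp)
    e.open_source.uniqueMDiffOn
  have hX' := hX.comp_contMDiffOn (contMDiffOn_chart_symm he)
  have h' := (contMDiff_snd_tangentBundle_modelSpace (n := ∞) (E n) (𝓡 n)).comp_contMDiffOn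
    (h.comp hX' fun x hx ↦ e.map_target hx)
  have h'' := (EuclideanSpace.proj i : E n →L[ℝ] ℝ).contDiff.comp_contDiffOn
    (contMDiffOn_iff_contDiffOn.mp h')
  refine h''.congr fun x hx ↦ ?_
  simp only [Function.comp, tangentMapWithin, vecComp,
    mfderivWithin_of_isOpen e.open_source (e.map_target hx)]

theorem contDiffOn_funComp (he : e ∈ atlas (E n) M) {u : M → ℝ}
    (hu : ContMDiff (𝓡 n) 𝓘(ℝ, ℝ) ∞ u) : ContDiffOn ℝ ∞ (funComp e u) e.target :=
  contMDiffOn_iff_contDiffOn.mp (hu.comp_contMDiffOn (contMDiffOn_chart_symm he))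

theorem sum_vecComp_smul_frame (he : e ∈ atlas (E n) M) (X : ∀ p : M, TangentSpace (𝓡 n) p)
    {x : E n} (hx : x ∈ e.target) : ∑ k, vecComp e X k x • frame e k x = X (e.symm x) := by
  have h := (mdifferentiable_chart he).symm_comp_deriv (e.map_target hx)
  rw [e.right_inv hx] at h
  exact (mfderiv_chart_symm_apply x _).symm.trans (DFunLike.congr_fun h (X (e.symm x)))

theorem eq_zero_of_sum_smul_frame_eq_zero (he : e ∈ atlas (E n) M) {x : E n} (hx : x ∈ e.target)
    (c : Fin n → ℝ) (h0 : ∑ k, c k • frame e k x = 0) : c = 0 := by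
  have h := (mdifferentiable_chart he).comp_symm_deriv hx
  have h' : mfderiv (𝓡 n) (𝓡 n) e (e.symm x) (mfderiv (𝓡 n) (𝓡 n) e.symm x
      (WithLp.toLp 2 c : E n)) = (WithLp.toLp 2 c : E n) :=
    DFunLike.congr_fun h (WithLp.toLp 2 c : E n)
  have h2 : mfderiv (𝓡 n) (𝓡 n) e.symm x (WithLp.toLp 2 c : E n) = 0 :=
    (mfderiv_chart_symm_apply x _).trans h0
  rw [h2, map_zero] at h'
  funext i
  exact (congrArg (fun w : E n ↦ w i) h').symm

theorem posDef_gMat (g : Metric n M) (he : e ∈ atlas (E n) M) {x : E n} (hx : x ∈ e.target) :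
    (gMat g e x).PosDef := by
  refine Matrix.PosDef.of_dotProduct_mulVec_pos ?_ fun c hc ↦ ?_
  · ext i j
    simp [gMat, g.symm (e.symm x) (frame e i x)]
  · have hv : ∑ k, c k • frame e k x ≠ 0 := fun h ↦ hc (eq_zero_of_sum_smul_frame_eq_zero he hx c h)
    refine (g.pos _ _ hv).trans_eq ?_
    simp only [map_sum, map_smul, sum_apply, smul_apply, smul_eq_mul, dotProduct, Matrix.mulVec,
      gMat, Matrix.of_apply, Finset.mul_sum, star_trivial]
    rw [Finset.sum_comm]
    refine Finset.sum_congr rfl fun i _ ↦ Finset.sum_congr rfl fun j _ ↦ ?_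
    ring

theorem pd_funComp (he : e ∈ atlas (E n) M) {u : M → ℝ} (hu : ContMDiff (𝓡 n) 𝓘(ℝ, ℝ) ∞ u)
    {x : E n} (hx : x ∈ e.target) (j : Fin n) :
    pd j (funComp e u) x =
      (mfderiv (𝓡 n) 𝓘(ℝ, ℝ) u (e.symm x) : TangentSpace (𝓡 n) (e.symm x) →L[ℝ] ℝ)
        (frame e j x) := by
  have h := mfderiv_comp x (hu.mdifferentiable (by simp) (e.symm x))
    ((mdifferentiable_chart he).mdifferentiableAt_symm hx)
  rw [mfderiv_eq_fderiv] at h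
  exact DFunLike.congr_fun h (EuclideanSpace.single j 1 : E n)

/-- Lowering the index of the gradient gives `du`. This form permits differentiation without
differentiating the inverse metric. -/
theorem sum_vecComp_grad_mul_gMat (g : Metric n M) (he : e ∈ atlas (E n) M) {u : M → ℝ}
    (hu : ContMDiff (𝓡 n) 𝓘(ℝ, ℝ) ∞ u) {x : E n} (hx : x ∈ e.target) (j : Fin n) :
    ∑ k, vecComp e (grad g u) k x * gMat g e x k j = pd j (funComp e u) x := by
  rw [pd_funComp he hu hx, ← inner_grad, ← sum_vecComp_smul_frame he (grad g u) hx]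
  simp [gMat]

end ChartSmoothness

/-! ### The Lie derivative of the metric: its trace, gradient fields, additivity -/

section Tensors

variable {n : ℕ} {M : Type*} [TopologicalSpace M] [ChartedSpace (E n) M] [IsManifold (𝓡 n) ∞ M]
  {e : OpenPartialHomeomorph M (E n)} {g : Metric n M} {x : E n}

theorem pd_congr {F G : E n → ℝ} (h : F =ᶠ[𝓝 x] G) (i : Fin n) : pd i F x = pd i G x := by
  rw [pd, pd, h.fderiv_eq]

theorem pd_add {F G : E n → ℝ} (hF : DifferentiableAt ℝ F x) (hG : DifferentiableAt ℝ G x)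
    (i : Fin n) : pd i (fun y ↦ F y + G y) x = pd i F x + pd i G x := by
  rw [pd, fderiv_fun_add hF hG]
  rfl

theorem pd_mul {F G : E n → ℝ} (hF : DifferentiableAt ℝ F x) (hG : DifferentiableAt ℝ G x)
    (i : Fin n) : pd i (fun y ↦ F y * G y) x = pd i F x * G x + F x * pd i G x := by
  rw [pd, fderiv_fun_mul hF hG]
  simp [pd, add_comm, mul_comm]

theorem pd_sum {ι : Type*} (s : Finset ι) {F : ι → E n → ℝ} (hF : ∀ k, DifferentiableAt ℝ (F k) x)
    (i : Fin n) : pd i (fun y ↦ ∑ k ∈ s, F k y) x = ∑ k ∈ s, pd i (F k) x := by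
  rw [pd, fderiv_fun_sum fun k _ ↦ hF k, sum_apply]
  rfl

theorem pd_sqrt {F : E n → ℝ} (hF : DifferentiableAt ℝ F x) (h0 : F x ≠ 0) (i : Fin n) :
    pd i (fun y ↦ √(F y)) x = pd i F x / (2 * √(F x)) := by
  rw [pd, (hF.hasFDerivAt.sqrt h0).fderiv]
  simp [pd]
  ring

theorem differentiableAt_gMat (g : Metric n M) (he : e ∈ atlas (E n) M) (hx : x ∈ e.target)
    (i j : Fin n) : DifferentiableAt ℝ (fun y ↦ gMat g e y i j) x :=
  ((contDiffOn_gMat g he i j).contDiffAt (e.open_target.mem_nhds hx)).differentiableAt (by simp)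

theorem differentiableAt_vecComp (he : e ∈ atlas (E n) M) {X : ∀ p : M, TangentSpace (𝓡 n) p}
    (hX : SmoothVectorField X) (hx : x ∈ e.target) (i : Fin n) :
    DifferentiableAt ℝ (vecComp e X i) x :=
  ((contDiffOn_vecComp he hX i).contDiffAt (e.open_target.mem_nhds hx)).differentiableAt (by simp)

theorem gMat_comm (g : Metric n M) (y : E n) (i j : Fin n) : gMat g e y i j = gMat g e y j i :=
  g.symm _ _ _

theorem inv_gMat_comm (g : Metric n M) (y : E n) (i j : Fin n) :
    (gMat g e y)⁻¹ i j = (gMat g e y)⁻¹ j i := by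
  have h : (gMat g e y).IsSymm := by
    ext i j
    exact gMat_comm g y j i
  exact (h.inv.apply j i)

theorem sum_inv_gMat_mul_gMat (g : Metric n M) (he : e ∈ atlas (E n) M) (hx : x ∈ e.target)
    (i j : Fin n) : ∑ k, (gMat g e x)⁻¹ i k * gMat g e x k j = if i = j then 1 else 0 := by
  rw [← Matrix.mul_apply, Matrix.nonsing_inv_mul _ (posDef_gMat g he hx).det_pos.ne'.isUnit,
    Matrix.one_apply]

/-- The trace of `½ 𝓛_X g` is the divergence of `X`. -/
theorem trace_lieMetric (g : Metric n M) (he : e ∈ atlas (E n) M) (hx : x ∈ e.target)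
    {X : ∀ p : M, TangentSpace (𝓡 n) p} (hX : ∀ k, DifferentiableAt ℝ (vecComp e X k) x) :
    ∑ i, ∑ j, (gMat g e x)⁻¹ i j * lieMetric g e X i j x = 2 * divergence g e X x := by
  have hdet := (posDef_gMat g he hx).det_pos
  obtain ⟨hd, hJ⟩ := differentiableAt_det_and_pd_det (differentiableAt_gMat g he hx)
  have hadj : ∀ i j, (gMat g e x).adjugate i j = (gMat g e x).det * (gMat g e x)⁻¹ i j := by
    intro i j
    rw [Matrix.inv_def, Matrix.smul_apply, Ring.inverse_eq_inv', smul_eq_mul,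
      mul_inv_cancel_left₀ hdet.ne']
  -- Jacobi's formula for `√det g` gives `div X = ∂ₖXᵏ + ½ Xᵏ gⁱʲ ∂ₖgᵢⱼ`. In the trace of `𝓛_X g`,
  -- each of the two terms with derivatives of `X` contributes `∂ₖXᵏ`.
  have hdiv : divergence g e X x = ∑ k, (pd k (vecComp e X k) x +
      (1 / 2) * vecComp e X k x *
        ∑ i, ∑ j, (gMat g e x)⁻¹ i j * pd k (fun y ↦ gMat g e y i j) x) := by
    rw [divergence, Finset.mul_sum]
    refine Finset.sum_congr rfl fun k _ ↦ ?_
    rw [pd_mul (hd.sqrt hdet.ne') (hX k), pd_sqrt hd hdet.ne', hJ]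
    have hs := Real.sqrt_pos.mpr hdet
    have hsq := Real.sq_sqrt hdet.le
    have hS : ∑ i, ∑ j, (gMat g e x).adjugate j i * pd k (fun y ↦ gMat g e y i j) x =
        √(gMat g e x).det ^ 2 *
          ∑ i, ∑ j, (gMat g e x)⁻¹ i j * pd k (fun y ↦ gMat g e y i j) x := by
      simp only [hsq, hadj, Finset.mul_sum, mul_assoc, inv_gMat_comm g x]
    rw [hS]
    field_simp
    ring
  have h₂ : ∀ k : Fin n, ∑ i, ∑ j, (gMat g e x)⁻¹ i j * (pd i (vecComp e X k) x * gMat g e x k j)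
      = pd k (vecComp e X k) x := fun k ↦ by
    have : ∀ i, ∑ j, (gMat g e x)⁻¹ i j * (pd i (vecComp e X k) x * gMat g e x k j) =
        pd i (vecComp e X k) x * if i = k then 1 else 0 := fun i ↦ by
      rw [← sum_inv_gMat_mul_gMat g he hx, Finset.mul_sum]
      refine Finset.sum_congr rfl fun j _ ↦ ?_
      rw [gMat_comm g x k j]
      ring
    simp [this]
  have h₃ : ∀ k : Fin n, ∑ i, ∑ j, (gMat g e x)⁻¹ i j * (pd j (vecComp e X k) x * gMat g e x i k)
      = pd k (vecComp e X k) x := fun k ↦ by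
    rw [Finset.sum_comm, ← h₂ k]
    refine Finset.sum_congr rfl fun j _ ↦ Finset.sum_congr rfl fun i _ ↦ ?_
    rw [gMat_comm g x k i, inv_gMat_comm g x i j]
  rw [hdiv, Finset.mul_sum]
  calc _ = ∑ k, ∑ i, ∑ j, (gMat g e x)⁻¹ i j * (vecComp e X k x * pd k (fun y ↦ gMat g e y i j) x
    + pd i (vecComp e X k) x * gMat g e x k j + pd j (vecComp e X k) x * gMat g e x i k) := by
        simp only [lieMetric, Finset.mul_sum]
        conv_rhs => rw [Finset.sum_comm]; enter [2, i]; rw [Finset.sum_comm]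
    _ = _ := by
      refine Finset.sum_congr rfl fun k _ ↦ ?_
      simp only [mul_add, Finset.sum_add_distrib]
      rw [h₂, h₃]
      have : ∑ i, ∑ j, (gMat g e x)⁻¹ i j * (vecComp e X k x * pd k (fun y ↦ gMat g e y i j) x) =
          vecComp e X k x * ∑ i, ∑ j, (gMat g e x)⁻¹ i j * pd k (fun y ↦ gMat g e y i j) x := by
        simp only [Finset.mul_sum, mul_left_comm]
      rw [this]
      ring

/-- `𝓛_{∇u} g = 2 ∇²u`. -/
theorem lieMetric_grad (he : e ∈ atlas (E n) M) (hx : x ∈ e.target) {u : M → ℝ}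
    (hu : ContMDiff (𝓡 n) 𝓘(ℝ, ℝ) ∞ u)
    (hd : ∀ k, DifferentiableAt ℝ (vecComp e (grad g u) k) x) (i j : Fin n) :
    lieMetric g e (grad g u) i j x = 2 * hess g e u i j x := by
  set V := vecComp e (grad g u) with hV
  -- The product rule applied to `Vᵏ gₖⱼ = ∂ⱼu`, an identity near `x`. It trades derivatives of `V`
  -- for second derivatives of `u` and first derivatives of `g`; the latter assemble into the
  -- Christoffel term `hΓ`.
  have hlow : ∀ i j, ∑ k, pd i (V k) x * gMat g e x k j =
      pd i (pd j (funComp e u)) x - ∑ k, V k x * pd i (fun y ↦ gMat g e y j k) x := fun i j ↦ by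
    simp only [gMat_comm g _ j]
    have h : (fun y ↦ ∑ k, V k y * gMat g e y k j) =ᶠ[𝓝 x] pd j (funComp e u) := by
      filter_upwards [e.open_target.mem_nhds hx] with y hy
      exact sum_vecComp_grad_mul_gMat g he hu hy j
    rw [← pd_congr h, pd_sum _ fun k ↦ (hd k).fun_mul (differentiableAt_gMat g he hx k j)]
    simp only [pd_mul (hd _) (differentiableAt_gMat g he hx _ j), Finset.sum_add_distrib]
    ring
  have hraise : ∀ l, ∑ k, (gMat g e x)⁻¹ k l * pd k (funComp e u) x = V l x := fun l ↦ by
    simp only [← sum_vecComp_grad_mul_gMat g he hu hx, Finset.mul_sum]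
    rw [Finset.sum_comm]
    have : ∀ m, ∑ k, (gMat g e x)⁻¹ k l * (vecComp e (grad g u) m x * gMat g e x m k) =
        V m x * if l = m then 1 else 0 := fun m ↦ by
      rw [← sum_inv_gMat_mul_gMat g he hx, Finset.mul_sum]
      refine Finset.sum_congr rfl fun k _ ↦ ?_
      rw [gMat_comm g x k m, inv_gMat_comm g x k l]
      ring
    simp [this]
  have hΓ : ∑ k, christoffel g e k i j x * pd k (funComp e u) x = (1 / 2) * ∑ l, V l x *
      (pd i (fun y ↦ gMat g e y j l) x + pd j (fun y ↦ gMat g e y i l) x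
        - pd l (fun y ↦ gMat g e y i j) x) := by
    simp only [← hraise, christoffel, Finset.mul_sum, Finset.sum_mul]
    rw [Finset.sum_comm]
    refine Finset.sum_congr rfl fun l _ ↦ Finset.sum_congr rfl fun k _ ↦ ?_
    ring
  have hsymm : pd i (pd j (funComp e u)) x = pd j (pd i (funComp e u)) x := by
    have hc : ContDiffAt ℝ ∞ (funComp e u) x :=
      (contDiffOn_funComp he hu).contDiffAt (e.open_target.mem_nhds hx)
    rw [pd_pd_eq_fderiv_fderiv (hc.of_le (WithTop.coe_le_coe.mpr le_top)),
      pd_pd_eq_fderiv_fderiv (hc.of_le (WithTop.coe_le_coe.mpr le_top))]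
    exact (hc.of_le (m := 2) (WithTop.coe_le_coe.mpr le_top)).isSymmSndFDerivAt (by simp) _ _
  have hswap : ∑ k, pd j (V k) x * gMat g e x i k = ∑ k, pd j (V k) x * gMat g e x k i := by
    simp only [gMat_comm g x i]
  rw [lieMetric, hess, hΓ]
  simp only [Finset.sum_add_distrib]
  rw [hswap, hlow, hlow, ← hsymm]
  simp only [mul_sub, mul_add, Finset.sum_sub_distrib, Finset.sum_add_distrib]
  ring

theorem lieMetric_add {X Y Z : ∀ p : M, TangentSpace (𝓡 n) p} (h : ∀ p, X p = Y p + Z p)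
    (hY : ∀ k, DifferentiableAt ℝ (vecComp e Y k) x)
    (hZ : ∀ k, DifferentiableAt ℝ (vecComp e Z k) x) (i j : Fin n) :
    lieMetric g e X i j x = lieMetric g e Y i j x + lieMetric g e Z i j x := by
  have hX : ∀ k, vecComp e X k = fun y ↦ vecComp e Y k y + vecComp e Z k y := fun k ↦ by
    funext y
    simp only [vecComp, h, map_add]
    exact map_add (EuclideanSpace.proj k : E n →L[ℝ] ℝ) _ _
  simp only [lieMetric, hX, pd_add (hY _) (hZ _), ← Finset.sum_add_distrib]
  refine Finset.sum_congr rfl fun k _ ↦ ?_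
  ring

end Tensors

/-! ### Harmonic functions and the conclusion -/

section Laplacian

variable {n : ℕ} {M : Type*} [TopologicalSpace M] [ChartedSpace (E n) M] [IsManifold (𝓡 n) ∞ M]
  {e : OpenPartialHomeomorph M (E n)}

theorem continuousOn_inv_gMat (g : Metric n M) (he : e ∈ atlas (E n) M) (i j : Fin n) :
    ContinuousOn (fun x ↦ (gMat g e x)⁻¹ i j) e.target := by
  have hG : ContinuousOn (gMat g e) e.target :=
    continuousOn_pi.mpr fun i ↦ continuousOn_pi.mpr fun j ↦ (contDiffOn_gMat g he i j).continuousOn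
  have hdet : ContinuousOn (fun x ↦ (gMat g e x).det) e.target :=
    (Continuous.matrix_det continuous_id).comp_continuousOn hG
  have hadj : ContinuousOn (fun x ↦ (gMat g e x).adjugate i j) e.target :=
    ((Continuous.matrix_adjugate continuous_id).matrix_elem i j).comp_continuousOn hG
  refine ((hdet.inv₀ fun x hx ↦ (posDef_gMat g he hx).det_pos.ne').mul hadj).congr fun x _ ↦ ?_
  simp [Matrix.inv_def, Ring.inverse_eq_inv']

theorem continuousOn_christoffel (g : Metric n M) (he : e ∈ atlas (E n) M) (k i j : Fin n) :
    ContinuousOn (christoffel g e k i j) e.target := by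
  have hpd : ∀ l i j, ContinuousOn (pd l fun y ↦ gMat g e y i j) e.target := fun l i j ↦
    ((contDiffOn_gMat g he i j).continuousOn_fderiv_of_isOpen e.open_target (by simp)).clm_apply
      continuousOn_const
  exact continuousOn_const.mul (continuousOn_finsetSum _ fun l _ ↦
    (continuousOn_inv_gMat g he k l).mul (((hpd i j l).add (hpd j i l)).sub (hpd l i j)))

/-- The first order coefficients `-gⁱʲ Γᵏᵢⱼ` of the Laplace–Beltrami operator. -/
noncomputable def laplaceDrift (g : Metric n M) (e : OpenPartialHomeomorph M (E n)) (x : E n)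
    (k : Fin n) : ℝ :=
  -∑ i, ∑ j, (gMat g e x)⁻¹ i j * christoffel g e k i j x

theorem continuousOn_laplaceDrift (g : Metric n M) (he : e ∈ atlas (E n) M) (k : Fin n) :
    ContinuousOn (fun x ↦ laplaceDrift g e x k) e.target :=
  (continuousOn_finsetSum _ fun i _ ↦ continuousOn_finsetSum _ fun j _ ↦
    (continuousOn_inv_gMat g he i j).mul (continuousOn_christoffel g he k i j)).neg

/-- The Laplace–Beltrami operator is the trace of the Hessian. -/
theorem secondOrderOp_eq_trace_hess (g : Metric n M) (u : M → ℝ) (x : E n) :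
    secondOrderOp (fun y ↦ (gMat g e y)⁻¹) (laplaceDrift g e) (funComp e u) x =
      ∑ i, ∑ j, (gMat g e x)⁻¹ i j * hess g e u i j x := by
  simp only [secondOrderOp, hess, mul_sub, Finset.sum_sub_distrib, laplaceDrift, neg_mul,
    Finset.sum_neg_distrib, Finset.sum_mul, Finset.mul_sum, ← sub_eq_add_neg]
  congr 1
  rw [Finset.sum_comm]
  refine Finset.sum_congr rfl fun i _ ↦ ?_
  rw [Finset.sum_comm]
  simp only [mul_assoc]

/-- On a compact connected manifold every harmonic function is constant. -/
theorem eq_const_of_trace_hess_eq_zero [CompactSpace M] [ConnectedSpace M] (g : Metric n M)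
    {u : M → ℝ} (hu : ContMDiff (𝓡 n) 𝓘(ℝ, ℝ) ∞ u)
    (h : ∀ e ∈ atlas (E n) M, ∀ x ∈ e.target,
      ∑ i, ∑ j, (gMat g e x)⁻¹ i j * hess g e u i j x = 0) : ∃ c, ∀ p, u p = c := by
  obtain ⟨p₀, -, hp₀⟩ := isCompact_univ.exists_isMaxOn univ_nonempty hu.continuous.continuousOn
  have hmax : ∀ p, u p ≤ u p₀ := fun p ↦ hp₀ (mem_univ p)
  refine ⟨u p₀, fun p ↦ ?_⟩
  -- Closed by continuity; open by the strong maximum principle in the chart at each of its points,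
  -- where the coordinate expression of `u` also attains its maximum.
  have hclopen : IsClopen {p | u p = u p₀} := by
    refine ⟨isClosed_eq hu.continuous continuous_const, isOpen_iff_mem_nhds.mpr fun q hq ↦ ?_⟩
    have hq : u q = u p₀ := hq
    set e := chartAt (E n) q
    have he : e ∈ atlas (E n) M := chart_mem_atlas _ q
    have hqs : q ∈ e.source := mem_chart_source _ q
    have hval : funComp e u (e q) = u p₀ := by rw [funComp, e.left_inv hqs, hq]
    have hloc := eventually_eq_of_isMaxOn (a := fun y ↦ (gMat g e y)⁻¹) (b := laplaceDrift g e)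
      e.open_target ((contDiffOn_funComp he hu).of_le (WithTop.coe_le_coe.mpr le_top))
      (continuousOn_inv_gMat g he) (fun x hx ↦ (posDef_gMat g he hx).inv)
      (continuousOn_laplaceDrift g he)
      (fun x hx ↦ (secondOrderOp_eq_trace_hess g u x).trans (h e he x hx))
      (e.map_source hqs) (fun x _ ↦ hval ▸ hmax _)
    filter_upwards [(e.continuousAt hqs).eventually hloc, e.open_source.mem_nhds hqs] with p hp hps
    rw [hval, funComp, e.left_inv hps] at hp
    exact hp
  have := hclopen.eq_univ ⟨p₀, rfl⟩
  exact this.ge (mem_univ p)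

theorem trace_hess_sub (g : Metric n M) (he : e ∈ atlas (E n) M) {x : E n} (hx : x ∈ e.target)
    {u v : M → ℝ} (hu : ContMDiff (𝓡 n) 𝓘(ℝ, ℝ) ∞ u) (hv : ContMDiff (𝓡 n) 𝓘(ℝ, ℝ) ∞ v) :
    ∑ i, ∑ j, (gMat g e x)⁻¹ i j * hess g e (fun p ↦ u p - v p) i j x =
      ∑ i, ∑ j, (gMat g e x)⁻¹ i j * (hess g e u i j x - hess g e v i j x) := by
  have hc : ∀ {w : M → ℝ}, ContMDiff (𝓡 n) 𝓘(ℝ, ℝ) ∞ w → ContDiffAt ℝ 2 (funComp e w) x :=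
    fun hw ↦ ((contDiffOn_funComp he hw).contDiffAt (e.open_target.mem_nhds hx)).of_le
      (WithTop.coe_le_coe.mpr le_top)
  have h : funComp e (fun p ↦ u p - v p) = fun y ↦ funComp e u y + (-1) * funComp e v y := by
    funext y
    simp only [funComp]
    ring
  rw [← secondOrderOp_eq_trace_hess, h, secondOrderOp_add_smul (hc hu) (hc hv),
    secondOrderOp_eq_trace_hess, secondOrderOp_eq_trace_hess]
  simp only [mul_sub, Finset.sum_sub_distrib]
  ring

/-- The two soliton equations differ by `∇²(f - h) = ½ 𝓛_Y g`, whose trace is `div Y = 0`. -/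
theorem trace_hess_sub_eq_zero {g : Metric n M} {X : ∀ p : M, TangentSpace (𝓡 n) p}
    {lam mu : M → ℝ} {η : ∀ p : M, TangentSpace (𝓡 n) p →L[ℝ] ℝ} {h f : M → ℝ}
    (hsol : IsAlmostEtaRicciSoliton g X lam mu η) (hpot : IsHodgeDeRhamPotential g X h)
    (hgrad : IsGradientAlmostEtaRicciSoliton g f lam mu η) (he : e ∈ atlas (E n) M) {x : E n}
    (hx : x ∈ e.target) :
    ∑ i, ∑ j, (gMat g e x)⁻¹ i j * hess g e (fun p ↦ f p - h p) i j x = 0 := by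
  obtain ⟨hh, Y, hY, hdiv, hXY⟩ := hpot
  have hYd := differentiableAt_vecComp he hY hx
  -- Regularity of `∇h` is read off from `∇h = X - Y`, a difference of smooth fields.
  have hgd : ∀ k, DifferentiableAt ℝ (vecComp e (grad g h) k) x := fun k ↦ by
    have : vecComp e (grad g h) k = fun y ↦ vecComp e X k y - vecComp e Y k y := by
      funext y
      have hg : grad g h (e.symm y) = X (e.symm y) - Y (e.symm y) := by rw [hXY]; abel
      simp only [vecComp, hg, map_sub]
      exact map_sub (EuclideanSpace.proj k : E n →L[ℝ] ℝ) _ _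
    rw [this]
    exact (differentiableAt_vecComp he hsol.smooth_X hx k).fun_sub (hYd k)
  have hhess : ∀ i j, hess g e f i j x - hess g e h i j x = (1 / 2) * lieMetric g e Y i j x :=
    fun i j ↦ by
      have h₁ := hsol.eqn e he x hx i j
      have h₂ := hgrad.eqn e he x hx i j
      rw [lieMetric_add hXY hgd hYd, lieMetric_grad he hx hh hgd] at h₁
      linarith
  rw [trace_hess_sub g he hx hgrad.smooth_f hh]
  have htr := trace_lieMetric g he hx hYd
  rw [hdiv e he x hx, mul_zero] at htr
  simp only [hhess, mul_left_comm _ (1 / 2 : ℝ), ← Finset.mul_sum, htr, mul_zero]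

end Laplacian

end Riem

theorem theorem1 {n : ℕ} {M : Type*} [TopologicalSpace M] [T2Space M] [CompactSpace M]
    [ConnectedSpace M] [ChartedSpace (Riem.E n) M] [IsManifold (𝓡 n) ∞ M]
    (g : Riem.Metric n M) (X : ∀ p : M, TangentSpace (𝓡 n) p) (lam mu : M → ℝ)
    (η : ∀ p : M, TangentSpace (𝓡 n) p →L[ℝ] ℝ) (h f : M → ℝ)
    (hsol : Riem.IsAlmostEtaRicciSoliton g X lam mu η)
    (hpot : Riem.IsHodgeDeRhamPotential g X h)
    (hgrad : Riem.IsGradientAlmostEtaRicciSoliton g f lam mu η) :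
    ∃ c : ℝ, ∀ p : M, f p = h p + c := by
  obtain ⟨c, hc⟩ := Riem.eq_const_of_trace_hess_eq_zero g (hgrad.smooth_f.sub hpot.1)
    fun e he x hx ↦ Riem.trace_hess_sub_eq_zero hsol hpot hgrad he hx
  exact ⟨c, fun p ↦ by linarith [show f p - h p = c from hc p]⟩
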